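/- Let $(W,S)$ be a Coxeter system with Coxeter matrix $(m_{sr})$ and let $\le$ be the Bruhat order on $W$: $x\le y$ if some reduced word of $y$ has a (not necessarily contiguous) subword that is a reduced word of $x$. Let $\mathcal H$ be the Hecke algebra of $(W,S)$, that is, the $\mathbb Z[v,v^{-1}]$-algebra with generators $h_s$ ($s\in S$) and relations $$h_s^2=(v^{-1}-v)h_s+1\quad(s\in S),\qquad \underbrace{h_sh_rh_s\cdots}_{m_{sr}}=\underbrace{h_rh_sh_r\cdots}_{m_{sr}}\quad(s,r\in S,\ m_{sr}<\infty).$$ For $x\in W$ put $h_x=h_sh_r\cdots h_t$, where $(s,r,\dots,t)$ is a reduced word of $x$ (the product does not depend on the choice of this word). Let $d:\mathcal H\to\mathcal H$ be the duality, that is, the ring homomorphism with $d(v)=v^{-1}$ and $d(h_s)=h_s^{-1}$ for $s\in S$ (so that $d(h_x)=(h_{x^{-1}})^{-1}$ for all $x\in W$); an element $b\in\mathcal H$ is called self-dual if $d(b)=b$. Theorem (Kazhdan–Lusztig). For every $x\in W$ there is a unique self-dual element $b_x\in\mathcal H$ with $$b_x\in h_x+\sum_{y\in W}v\mathbb Z[v]\,h_y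 .$$ Moreover there is a unique self-dual element of $h_x+\sum_{y<x}v\mathbb Z[v]\,h_y$; since this set is contained in the previous one, that element is $b_x$. The family $(b_x)_{x\in W}$ is a basis of $\mathcal H$ as a $\mathbb Z[v,v^{-1}]$-module (the Kazhdan–Lusztig basis). -/

import Mathlib

open scoped LaurentPolynomial

noncomputable section

namespace KazhdanLusztig

variable {B : Type*}

/-- The indeterminate `v` of `ℤ[v, v⁻¹]`. -/
def v : ℤ[T;T⁻¹] := LaurentPolynomial.T 1

/-- The inverse `v⁻¹` of the indeterminate of `ℤ[v, v⁻¹]`. -/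
def vInv : ℤ[T;T⁻¹] := LaurentPolynomial.T (-1)

/-- The defining relations of the Hecke algebra, on the free `ℤ[v, v⁻¹]`-algebra with one generator
for each simple reflection. `braidWord M i j` and `braidWord M j i` are the two alternating words
in `i, j` of length `M i j`; Mathlib encodes `m = ∞` as `M i j = 0`, where both are empty and the
relation is void. -/
inductive HeckeRel (M : CoxeterMatrix B) :
    FreeAlgebra ℤ[T;T⁻¹] B → FreeAlgebra ℤ[T;T⁻¹] B → Prop
  | quadratic (i : B) :
      HeckeRel M (FreeAlgebra.ι ℤ[T;T⁻¹] i * FreeAlgebra.ι ℤ[T;T⁻¹] i)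
        ((vInv - v) • FreeAlgebra.ι ℤ[T;T⁻¹] i + 1)
  | braid (i j : B) :
      HeckeRel M ((CoxeterSystem.braidWord M i j).map (FreeAlgebra.ι ℤ[T;T⁻¹])).prod
        ((CoxeterSystem.braidWord M j i).map (FreeAlgebra.ι ℤ[T;T⁻¹])).prod

/-- The Hecke algebra over `ℤ[v, v⁻¹]`, by generators and relations. -/
abbrev Hecke (M : CoxeterMatrix B) : Type _ := RingQuot (HeckeRel M)

variable (M : CoxeterMatrix B)

/-- The generator `h_s` of the Hecke algebra. -/
def gen (i : B) : Hecke M := RingQuot.mkAlgHom ℤ[T;T⁻¹] (HeckeRel M) (FreeAlgebra.ι ℤ[T;T⁻¹] i)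

/-- The product `h_s h_r ⋯ h_t` along a word `(s, r, …, t)`. -/
def wordElt (ω : List B) : Hecke M := (ω.map (gen M)).prod

theorem gen_mul_gen (i : B) : gen M i * gen M i = (vInv - v) • gen M i + 1 := by
  have h := RingQuot.mkAlgHom_rel ℤ[T;T⁻¹] (HeckeRel.quadratic (M := M) i)
  simpa only [gen, map_mul, map_add, map_smul, map_one] using h

theorem wordElt_braidWord (i j : B) :
    wordElt M (CoxeterSystem.braidWord M i j) = wordElt M (CoxeterSystem.braidWord M j i) := by
  have h := RingQuot.mkAlgHom_rel ℤ[T;T⁻¹] (HeckeRel.braid (M := M) i j)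
  rw [map_list_prod, map_list_prod, List.map_map, List.map_map] at h
  exact h

/-- The inverse `h_s + v - v⁻¹` of `h_s`. -/
def genInv (i : B) : Hecke M := gen M i + algebraMap ℤ[T;T⁻¹] (Hecke M) (v - vInv)

theorem gen_mul_genInv (i : B) : gen M i * genInv M i = 1 := by
  rw [genInv, mul_add, gen_mul_gen, ← Algebra.commutes, ← Algebra.smul_def, add_right_comm,
    ← add_smul]
  simp

theorem genInv_mul_gen (i : B) : genInv M i * gen M i = 1 := by
  rw [← gen_mul_genInv M i, genInv, mul_add, add_mul, Algebra.commutes]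

theorem genInv_mul_genInv (i : B) :
    genInv M i * genInv M i
      = algebraMap ℤ[T;T⁻¹] (Hecke M) (v - vInv) * genInv M i + 1 := by
  nth_rw 1 [genInv]
  rw [add_mul, gen_mul_genInv, add_comm]

theorem wordElt_mul_genInv_reverse (ω : List B) :
    wordElt M ω * (ω.reverse.map (genInv M)).prod = 1 := by
  induction ω with
  | nil => simp [wordElt]
  | cons i ω ih =>
    have h : wordElt M (i :: ω) = gen M i * wordElt M ω := by simp [wordElt]
    rw [h, List.reverse_cons, List.map_append, List.prod_append, mul_assoc,
      ← mul_assoc (wordElt M ω), ih]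
    simp [gen_mul_genInv]

theorem genInv_reverse_mul_wordElt (ω : List B) :
    (ω.reverse.map (genInv M)).prod * wordElt M ω = 1 := by
  induction ω with
  | nil => simp [wordElt]
  | cons i ω ih =>
    have h : wordElt M (i :: ω) = gen M i * wordElt M ω := by simp [wordElt]
    have h' : (([i] : List B).map (genInv M)).prod * (gen M i * wordElt M ω) = wordElt M ω := by
      rw [← mul_assoc]
      simp [genInv_mul_gen]
    rw [h, List.reverse_cons, List.map_append, List.prod_append, mul_assoc, h', ih]

theorem reverse_alternatingWord (i j : B) (m : ℕ) :
    (CoxeterSystem.alternatingWord i j m).reverse =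
      if Even m then CoxeterSystem.alternatingWord j i m
      else CoxeterSystem.alternatingWord i j m := by
  induction m generalizing i j with
  | zero => simp [CoxeterSystem.alternatingWord]
  | succ m ih =>
    rw [CoxeterSystem.alternatingWord_succ, List.concat_eq_append, List.reverse_append, ih]
    by_cases hm : Even m
    · have h := CoxeterSystem.alternatingWord_succ' i j m
      rw [CoxeterSystem.alternatingWord_succ, List.concat_eq_append] at h
      simp [hm, Nat.even_add_one, h]
    · simp [hm, Nat.even_add_one, CoxeterSystem.alternatingWord_succ' j i]

theorem genInv_reverse_braidWord (i j : B) :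
    ((CoxeterSystem.braidWord M i j).reverse.map (genInv M)).prod
      = ((CoxeterSystem.braidWord M j i).reverse.map (genInv M)).prod := by
  refine left_inv_eq_right_inv (genInv_reverse_mul_wordElt M _) ?_
  rw [wordElt_braidWord]
  exact wordElt_mul_genInv_reverse M _

theorem genInv_braidWord (i j : B) :
    ((CoxeterSystem.braidWord M i j).map (genInv M)).prod
      = ((CoxeterSystem.braidWord M j i).map (genInv M)).prod := by
  have h := genInv_reverse_braidWord M i j
  unfold CoxeterSystem.braidWord at h ⊢
  rw [reverse_alternatingWord, reverse_alternatingWord, M.symmetric j i] at h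
  rw [M.symmetric j i]
  by_cases hm : Even (M i j)
  · simpa [hm] using h.symm
  · simpa [hm] using h

/-- The structure map of the Hecke algebra precomposed with `v ↦ v⁻¹`. -/
def barMap : ℤ[T;T⁻¹] →+* Hecke M :=
  (algebraMap ℤ[T;T⁻¹] (Hecke M)).comp (LaurentPolynomial.invert (R := ℤ)).toRingEquiv.toRingHom

/-- The Hecke algebra as a `ℤ[v, v⁻¹]`-algebra on which `v` acts by `v⁻¹`. It is used only to
construct the duality and is not an instance. -/
abbrev barAlgebra : Algebra ℤ[T;T⁻¹] (Hecke M) :=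
  (barMap M).toAlgebra' fun c x => Algebra.commutes (LaurentPolynomial.invert c) x

/-- The ring homomorphism from the free algebra with `v ↦ v⁻¹` and `s ↦ h_s⁻¹`. -/
def freeDuality : FreeAlgebra ℤ[T;T⁻¹] B →+* Hecke M :=
  letI := barAlgebra M
  (FreeAlgebra.lift ℤ[T;T⁻¹] (genInv M) : FreeAlgebra ℤ[T;T⁻¹] B →ₐ[ℤ[T;T⁻¹]] Hecke M).toRingHom

theorem freeDuality_ι (i : B) : freeDuality M (FreeAlgebra.ι ℤ[T;T⁻¹] i) = genInv M i := by
  let _ := barAlgebra M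
  exact FreeAlgebra.lift_ι_apply (R := ℤ[T;T⁻¹]) (genInv M) i

theorem freeDuality_algebraMap (p : ℤ[T;T⁻¹]) :
    freeDuality M (algebraMap ℤ[T;T⁻¹] _ p)
      = algebraMap ℤ[T;T⁻¹] (Hecke M) (LaurentPolynomial.invert p) := by
  let _ := barAlgebra M
  exact (FreeAlgebra.lift ℤ[T;T⁻¹] (genInv M) :
    FreeAlgebra ℤ[T;T⁻¹] B →ₐ[ℤ[T;T⁻¹]] Hecke M).commutes p

theorem freeDuality_rel ⦃a b : FreeAlgebra ℤ[T;T⁻¹] B⦄ (h : HeckeRel M a b) :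
    freeDuality M a = freeDuality M b := by
  cases h with
  | quadratic i =>
    rw [map_mul, map_add, map_one, Algebra.smul_def, map_mul, freeDuality_ι,
      freeDuality_algebraMap, genInv_mul_genInv]
    simp [v, vInv]
  | braid i j =>
    rw [map_list_prod, map_list_prod, List.map_map, List.map_map]
    have e : (freeDuality M : FreeAlgebra ℤ[T;T⁻¹] B → Hecke M) ∘ FreeAlgebra.ι ℤ[T;T⁻¹]
        = genInv M := funext (freeDuality_ι M)
    rw [e]
    exact genInv_braidWord M i j

/-- The duality `d` of the Hecke algebra: the ring endomorphism with `d(v) = v⁻¹` and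
`d(h_s) = h_s⁻¹` for simple `s` (equivalently, `d(h_x) = (h_{x⁻¹})⁻¹` for all `x`). -/
def duality : Hecke M →+* Hecke M :=
  RingQuot.lift ⟨freeDuality M, freeDuality_rel M⟩

theorem duality_gen (i : B) : duality M (gen M i) = genInv M i := by
  have h := RingQuot.lift_mkRingHom_apply (freeDuality M) (freeDuality_rel M)
    (FreeAlgebra.ι ℤ[T;T⁻¹] i)
  rw [freeDuality_ι, ← RingQuot.mkAlgHom_coe ℤ[T;T⁻¹] (HeckeRel M)] at h
  exact h

theorem duality_algebraMap (p : ℤ[T;T⁻¹]) :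
    duality M (algebraMap ℤ[T;T⁻¹] _ p)
      = algebraMap ℤ[T;T⁻¹] (Hecke M) (LaurentPolynomial.invert p) := by
  have h := RingQuot.lift_mkRingHom_apply (freeDuality M) (freeDuality_rel M)
    (algebraMap ℤ[T;T⁻¹] _ p)
  rw [freeDuality_algebraMap, ← RingQuot.mkAlgHom_coe ℤ[T;T⁻¹] (HeckeRel M)] at h
  rw [← h, ← (RingQuot.mkAlgHom ℤ[T;T⁻¹] (HeckeRel M)).commutes p]
  rfl

/-- `d(h_s h_r ⋯ h_t)` is the inverse of `h_t ⋯ h_r h_s`. -/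
theorem duality_wordElt_mul (ω : List B) :
    duality M (wordElt M ω) * wordElt M ω.reverse = 1 := by
  have h := genInv_reverse_mul_wordElt M ω.reverse
  have e : (duality M : Hecke M → Hecke M) ∘ gen M = genInv M := funext (duality_gen M)
  rw [List.reverse_reverse] at h
  rwa [wordElt, map_list_prod, List.map_map, e]

/-- An element of the Hecke algebra is self-dual if it is fixed by the duality. -/
def IsSelfDual (a : Hecke M) : Prop := duality M a = a

variable {M} {W : Type*} [Group W] (cs : CoxeterSystem M W)

/-- The element `h_x`: the product `h_s h_r ⋯ h_t` along a reduced word `(s, r, …, t)` of `x`.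
By Matsumoto's theorem it does not depend on which reduced word is chosen. -/
def stdElt (x : W) : Hecke M := wordElt M (cs.exists_isReduced x).choose

/-- The Bruhat order `x ≤ y`: some reduced word of `y` has a subword (not necessarily of
consecutive letters) which is a reduced word of `x`. -/
def BruhatLE (x y : W) : Prop :=
  ∃ ω : List B, cs.IsReduced ω ∧ cs.wordProd ω = y ∧
    ∃ ω' : List B, ω'.Sublist ω ∧ cs.IsReduced ω' ∧ cs.wordProd ω' = x

/-- The strict Bruhat order. -/
def BruhatLT (x y : W) : Prop := BruhatLE cs x y ∧ x ≠ y

/-- The sum of subgroups `∑_{y ∈ Y} v ℤ[v] h_y` of the Hecke algebra. -/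
def vSum (Y : Set W) : AddSubgroup (Hecke M) :=
  AddSubgroup.closure
    {a | ∃ y ∈ Y, ∃ p : Polynomial ℤ, a = (v * Polynomial.toLaurent p) • stdElt cs y}

end KazhdanLusztig

end

/-! Uniqueness is a unitriangularity argument. The duality sends `h_x` to `h_x` plus terms of
smaller length. If a self-dual element of `∑ v ℤ[v] h_y` is nonzero, its coefficient at a longest
element of the support lies in `v ℤ[v]` and is invariant under `v ↦ v⁻¹`, hence vanishes
(`eq_zero_of_isSelfDual`).

Existence is by induction on length. For `x = s y > y` the element `(h_s + v) b_y` is self-dual with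
leading term `h_x`. The only coefficients outside `v ℤ[v]` are integers at elements `z < y` with `s
z < z`; subtracting integer multiples of `b_z` removes them (`gen_add_mul_mem`). The resulting
family is unitriangular, hence a basis.

Both arguments require that the `h_x` form a basis of the algebra given by generators and relations.
The geometric representation bounds the order of `s_i s_j` from below, so alternating words of
length up to `M i j` are reduced. An action of `W` on signed group elements gives the strong
exchange property, from which follow Matsumoto's theorem, the description of the Bruhat order by
chains of reflections, and a regular representation on the free module on `W`. -/

open scoped LaurentPolynomial

noncomputable section

namespace KazhdanLusztig

variable {B : Type*}

/-! ### The geometric representation and the order of `s_i s_j` -/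

section Geometric

variable (M : CoxeterMatrix B)

open Polynomial.Chebyshev

/-- The linear form `2 (α_i, ·)` of the geometric representation, with `(α_i, α_j) = -cos (π / m)`
for `m = M i j`. -/
def coroot (i : B) : Module.Dual ℝ (B →₀ ℝ) :=
  Finsupp.linearCombination ℝ fun j => -2 * Real.cos (Real.pi / M i j)

theorem coroot_single (i j : B) :
    coroot M i (Finsupp.single j 1) = -2 * Real.cos (Real.pi / M i j) := by
  simp [coroot]

theorem coroot_single_self (i : B) : coroot M i (Finsupp.single i 1) = 2 := by
  simp [coroot_single]

/-- The simple reflections of the geometric representation. -/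
def geomReflection (i : B) : (B →₀ ℝ) ≃ₗ[ℝ] (B →₀ ℝ) :=
  Module.reflection (coroot_single_self M i)

/-- Powers of a product of two reflections are given by Chebyshev polynomials `S` at this number. As
it is `2 cos θ` with `θ = 2π / m`, the identity `S_n(2 cos θ) sin θ = sin ((n + 1) θ)` turns
statements about these powers into trigonometry. -/
theorem coroot_mul_coroot_sub_two (i j : B) :
    coroot M i (Finsupp.single j 1) * coroot M j (Finsupp.single i 1) - 2 =
      2 * Real.cos (2 * Real.pi / M i j) := by
  rw [coroot_single, coroot_single, M.symmetric j i, mul_div_assoc, Real.cos_two_mul]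
  ring

theorem sin_two_pi_div_ne_zero {m : ℕ} (hm : 3 ≤ m) : Real.sin (2 * Real.pi / m) ≠ 0 := by
  have hm' : (3 : ℝ) ≤ m := by exact_mod_cast hm
  refine (Real.sin_pos_of_pos_of_lt_pi (by positivity) ?_).ne'
  rw [div_lt_iff₀ (by positivity)]
  nlinarith [Real.pi_pos]

theorem S_eval_two_mul_cos_eq_zero {m : ℕ} (hm : 3 ≤ m) {k : ℤ} (hk : 2 * (k + 1) = m) :
    (S ℝ k).eval (2 * Real.cos (2 * Real.pi / m)) = 0 := by
  have h := S_two_mul_real_cos (2 * Real.pi / m) k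
  have hk' : (2 : ℝ) * (k + 1) = m := by exact_mod_cast hk
  have hm0 : (m : ℝ) ≠ 0 := by positivity
  have e : ((k : ℝ) + 1) * (2 * Real.pi / m) = Real.pi := by
    field_simp
    linarith
  rw [e, Real.sin_pi] at h
  exact (mul_eq_zero.mp h).resolve_right (sin_two_pi_div_ne_zero hm)

/-- With `θ = 2π / m`, the angles `(k + 1) θ` and `k θ` add up to `2π`, so their sines are opposite.
-/
theorem S_eval_add_S_eval_eq_zero {m : ℕ} (hm : 3 ≤ m) {k : ℤ} (hk : 2 * k + 1 = m) :
    (S ℝ k).eval (2 * Real.cos (2 * Real.pi / m))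
      + (S ℝ (k - 1)).eval (2 * Real.cos (2 * Real.pi / m)) = 0 := by
  have h := S_two_mul_real_cos (2 * Real.pi / m) k
  have h' := S_two_mul_real_cos (2 * Real.pi / m) (k - 1)
  have hk' : (2 : ℝ) * k + 1 = m := by exact_mod_cast hk
  have hm0 : (m : ℝ) ≠ 0 := by positivity
  have e : ((k : ℝ) + 1) * (2 * Real.pi / m) = 2 * Real.pi - k * (2 * Real.pi / m) := by
    field_simp
    linear_combination hk'
  have e' : (((k - 1 : ℤ) : ℝ) + 1) * (2 * Real.pi / m) = k * (2 * Real.pi / m) := by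
    push_cast; ring
  rw [e, Real.sin_two_pi_sub] at h
  rw [e'] at h'
  refine (mul_eq_zero.mp ?_).resolve_right (sin_two_pi_div_ne_zero hm)
  rw [add_mul, h, h', neg_add_cancel]

theorem geomReflection_isLiftable : M.IsLiftable (geomReflection M) := by
  intro i j
  -- Division by `sin (2π / m)` requires `m ≥ 3`. Of the rest, `m = 0` (that is, `∞`) is void, `m =
  -- 1` forces `i = j`, and for `m = 2` the two reflections commute.
  rcases Nat.lt_or_ge (M i j) 3 with hm | hm
  · have h012 : M i j = 0 ∨ M i j = 1 ∨ M i j = 2 := by omega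
    rcases h012 with h | h | h
    · rw [h, pow_zero]
    · obtain rfl : i = j := by
        by_contra hij
        exact M.off_diagonal i j hij h
      rw [h, pow_one]
      exact LinearEquiv.ext fun z => Module.involutive_reflection (coroot_single_self M i) z
    · have hij : coroot M i (Finsupp.single j 1) = 0 := by simp [coroot_single, h]
      have hji : coroot M j (Finsupp.single i 1) = 0 := by
        simp [coroot_single, M.symmetric j i, h]
      rw [h, pow_two]
      refine LinearEquiv.ext fun z => ?_
      simp only [geomReflection, LinearEquiv.mul_apply, Module.reflection_apply, map_sub, map_smul,
        hij, hji, coroot_single_self, LinearEquiv.coe_one, id]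
      module
  · refine LinearEquiv.ext fun z => ?_
    rw [geomReflection, geomReflection, Module.reflection_mul_reflection_pow_apply _ _ _ z _
      (coroot_mul_coroot_sub_two M i j).symm]
    -- Each coefficient in the power formula has a factor that vanishes: `S_{k-1}` for `m = 2k`, and
    -- `S_k + S_{k-1}` for `m = 2k + 1`.
    rcases Nat.even_or_odd' (M i j) with ⟨k, hk | hk⟩
    · have e1 : ((M i j : ℤ) - 2) / 2 = k - 1 := by omega
      have e2 : ((M i j : ℤ) - 1) / 2 = k - 1 := by omega
      have h := S_eval_two_mul_cos_eq_zero hm (k := k - 1) (by omega)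
      rw [e1, e2, h]
      simp
    · have e1 : ((M i j : ℤ) - 2) / 2 = k - 1 := by omega
      have e2 : ((M i j : ℤ) - 1) / 2 = k := by omega
      have e3 : ((M i j : ℤ) - 3) / 2 = k - 1 := by omega
      have e4 : (M i j : ℤ) / 2 = k := by omega
      have h := S_eval_add_S_eval_eq_zero hm (k := k) (by omega)
      rw [e1, e2, e3, e4, h]
      simp

/-- The power is applied to the basis vector of `i`. For `m ≥ 3`, the `j`-coordinate gives `sin (k
θ) = 0` and the `i`-coordinate then gives `cos (k θ) = 1`, where `θ = 2π / m`; so `m` divides `k`.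
-/
theorem geomReflection_mul_pow_ne_one {i j : B} (hij : i ≠ j) {k : ℕ} (hk : 0 < k)
    (hkM : M i j ≠ 0 → k < M i j) : (geomReflection M i * geomReflection M j) ^ k ≠ 1 := by
  intro h
  have h1 := Module.reflection_mul_reflection_pow_apply_self (coroot_single_self M i)
    (coroot_single_self M j) k _ (coroot_mul_coroot_sub_two M i j).symm
  change ((geomReflection M i * geomReflection M j) ^ k) _ = _ at h1
  rw [h, LinearEquiv.coe_one, id, coroot_single M j i, M.symmetric j i] at h1
  have hx := DFunLike.congr_fun h1 i
  have hy := DFunLike.congr_fun h1 j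
  simp only [Finsupp.add_apply, Finsupp.smul_apply, Finsupp.single_eq_same, smul_eq_mul,
    Finsupp.single_eq_of_ne hij, Finsupp.single_eq_of_ne hij.symm, mul_one, mul_zero,
    zero_add, add_zero] at hx hy
  have h1' := M.off_diagonal i j hij
  have h012 : M i j = 0 ∨ M i j = 2 ∨ 3 ≤ M i j := by omega
  rcases h012 with hm | hm | hm
  -- For `m = ∞`, encoded as `0`, division by zero makes the angle `0`, and `S_{k-1}(2) = k` is
  -- nonzero.
  · rw [hm] at hy
    simp [S_eval_two] at hy
    omega
  · have := hkM (by omega)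
    obtain rfl : k = 1 := by omega
    rw [hm] at hx
    norm_num at hx
  · have hlt := hkM (by omega)
    have hm' : (3 : ℝ) ≤ M i j := by exact_mod_cast hm
    have hcos : Real.cos (Real.pi / M i j) ≠ 0 := by
      refine (Real.cos_pos_of_mem_Ioo ⟨?_, ?_⟩).ne'
      · have : 0 < Real.pi / M i j := by positivity
        linarith [Real.pi_pos]
      · rw [div_lt_iff₀ (by positivity)]
        nlinarith [Real.pi_pos]
    have hS : (S ℝ ((k : ℤ) - 1)).eval (2 * Real.cos (2 * Real.pi / M i j)) = 0 := by
      refine (mul_eq_zero.mp hy.symm).resolve_right ?_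
      simpa using hcos
    rw [hS, add_zero] at hx
    have hs := sin_two_pi_div_ne_zero hm
    have hk1 := S_two_mul_real_cos (2 * Real.pi / M i j) k
    have hk0 := S_two_mul_real_cos (2 * Real.pi / M i j) (k - 1)
    rw [← hx, one_mul] at hk1
    rw [hS, zero_mul] at hk0
    have e0 : (((k - 1 : ℤ) : ℝ) + 1) * (2 * Real.pi / M i j) = k * (2 * Real.pi / M i j) := by
      push_cast; ring
    rw [e0] at hk0
    rw [Int.cast_natCast, add_mul, one_mul, Real.sin_add, ← hk0, zero_mul, zero_add] at hk1
    have hc : Real.cos (k * (2 * Real.pi / M i j)) = 1 := by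
      refine mul_right_cancel₀ hs ?_
      rw [one_mul, ← hk1]
    obtain ⟨n, hn⟩ := (Real.cos_eq_one_iff _).mp hc
    have hm0 : (M i j : ℝ) ≠ 0 := by positivity
    have hn' : (n : ℝ) * M i j = k := by
      field_simp at hn
      exact hn
    have hn'' : n * (M i j : ℤ) = k := by exact_mod_cast hn'
    have hpos : 0 < n := by
      by_contra hneg
      nlinarith
    nlinarith

end Geometric

variable {M : CoxeterMatrix B} {W : Type*} [Group W] (cs : CoxeterSystem M W)

open CoxeterSystem

theorem simple_mul_simple_pow_ne_one {i j : B} (hij : i ≠ j) {k : ℕ} (hk : 0 < k)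
    (hkM : M i j ≠ 0 → k < M i j) : (cs.simple i * cs.simple j) ^ k ≠ 1 := by
  intro h
  have h' := congrArg (cs.lift ⟨geomReflection M, geomReflection_isLiftable M⟩) h
  rw [map_pow, map_mul, cs.lift_apply_simple, cs.lift_apply_simple, map_one] at h'
  exact geomReflection_mul_pow_ne_one M hij hk hkM h'

/-! ### Inversion parity, strong exchange and reduced alternating words -/

section Inversions

theorem prod_map_alternatingWord_two_mul {G : Type*} [Monoid G] (f : B → G) (i j : B) (m : ℕ) :
    ((alternatingWord i j (2 * m)).map f).prod = (f i * f j) ^ m := by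
  induction m with
  | zero => simp [alternatingWord]
  | succ m ih =>
    have h : 2 * (m + 1) = 2 * m + 1 + 1 := by ring
    rw [h, alternatingWord_succ', alternatingWord_succ', pow_succ', ← ih]
    simp [mul_assoc]

-- Since `(s_i s_j)^m = 1`, the second half of the inversion sequence repeats the first. This is the
-- braid relation for the sign in `signedConj`.
open Classical in
theorem count_rightInvSeq_alternatingWord (i j : B) (t : W) :
    ((cs.rightInvSeq (alternatingWord i j (2 * M i j))).count t : ZMod 2) = 0 := by
  have hrev : (alternatingWord i j (2 * M i j)).reverse = alternatingWord j i (2 * M i j) := by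
    rw [reverse_alternatingWord, if_pos (even_two_mul _)]
  rw [← List.count_reverse, ← cs.leftInvSeq_reverse, hrev]
  set m := M i j with hm
  set L := cs.leftInvSeq (alternatingWord j i (2 * m)) with hL
  have hlen : L.length = 2 * m := by simp [hL]
  have hdrop : L.drop m = L.take m := by
    refine List.ext_getElem (by simp [hlen]; omega) fun k h1 h2 => ?_
    rw [List.getElem_drop, List.getElem_take]
    have hk : k < m := by
      rw [List.length_take] at h2
      omega
    simp only [hL]
    rw [cs.getElem_leftInvSeq_alternatingWord j i m (m + k) (by omega),
      cs.getElem_leftInvSeq_alternatingWord j i m k (by omega),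
      cs.prod_alternatingWord_eq_mul_pow, cs.prod_alternatingWord_eq_mul_pow]
    have e1 : (2 * (m + k) + 1) / 2 = m + k := by omega
    have e2 : (2 * k + 1) / 2 = k := by omega
    have o1 : ¬ Even (2 * (m + k) + 1) := by simp
    have o2 : ¬ Even (2 * k + 1) := by simp
    rw [e1, e2, if_neg o1, if_neg o2, pow_add, hm, cs.simple_mul_simple_pow, one_mul]
  rw [← List.take_append_drop m L, hdrop, List.count_append, Nat.cast_add]
  exact CharTwo.add_self_eq_zero _

open Classical in
/-- The action of a simple reflection on pairs of a group element and a sign, written additively: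
conjugation on the first component, a change of sign exactly at the reflection itself. -/
def signedConj (i : B) : Function.End (W × ZMod 2) := fun p =>
  (cs.simple i * p.1 * cs.simple i, p.2 + if p.1 = cs.simple i then 1 else 0)

open Classical in
theorem prod_map_signedConj (ω : List B) (p : W × ZMod 2) :
    (ω.map (signedConj cs)).prod p =
      (cs.wordProd ω * p.1 * (cs.wordProd ω)⁻¹, p.2 + (cs.rightInvSeq ω).count p.1) := by
  induction ω with
  | nil =>
    rw [List.map_nil, List.prod_nil]
    simp
    rfl
  | cons i ω ih =>
    rw [List.map_cons, List.prod_cons]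
    change signedConj cs i ((ω.map (signedConj cs)).prod p) = _
    rw [ih, signedConj, rightInvSeq, wordProd_cons, List.count_cons]
    have e : (cs.wordProd ω * p.1 * (cs.wordProd ω)⁻¹ = cs.simple i) ↔
        ((cs.wordProd ω)⁻¹ * cs.simple i * cs.wordProd ω = p.1) := by
      rw [mul_inv_eq_iff_eq_mul, mul_assoc, inv_mul_eq_iff_eq_mul, eq_comm]
    simp only [mul_inv_rev, inv_simple, mul_assoc, Nat.cast_add, beq_iff_eq] at e ⊢
    simp only [e, add_assoc]
    split_ifs <;> simp

theorem signedConj_isLiftable : M.IsLiftable (signedConj cs) := by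
  classical
  intro i j
  rw [← prod_map_alternatingWord_two_mul]
  funext p
  rw [prod_map_signedConj, count_rightInvSeq_alternatingWord, wordProd,
    prod_map_alternatingWord_two_mul]
  simp
  rfl

/-- The parity of the number of occurrences of `t` in the right inversion sequence of a word
of `w`. -/
def inversionParity (w t : W) : ZMod 2 :=
  (cs.lift ⟨signedConj cs, signedConj_isLiftable cs⟩ w (t, 0)).2

theorem lift_signedConj_wordProd (ω : List B) :
    cs.lift ⟨signedConj cs, signedConj_isLiftable cs⟩ (cs.wordProd ω) =
      (ω.map (signedConj cs)).prod := by
  rw [wordProd, map_list_prod, List.map_map]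
  congr 1
  exact List.map_congr_left fun i _ => cs.lift_apply_simple _ i

open Classical in
theorem inversionParity_wordProd (ω : List B) (t : W) :
    inversionParity cs (cs.wordProd ω) t = (cs.rightInvSeq ω).count t := by
  rw [inversionParity, lift_signedConj_wordProd, prod_map_signedConj, zero_add]

theorem lift_signedConj_apply (w : W) (p : W × ZMod 2) :
    cs.lift ⟨signedConj cs, signedConj_isLiftable cs⟩ w p =
      (w * p.1 * w⁻¹, p.2 + inversionParity cs w p.1) := by
  classical
  obtain ⟨ω, rfl⟩ := cs.wordProd_surjective w
  rw [inversionParity_wordProd, lift_signedConj_wordProd, prod_map_signedConj]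

theorem inversionParity_mul (x y t : W) :
    inversionParity cs (x * y) t =
      inversionParity cs y t + inversionParity cs x (y * t * y⁻¹) := by
  rw [inversionParity, map_mul]
  change (cs.lift ⟨signedConj cs, signedConj_isLiftable cs⟩ x
    (cs.lift ⟨signedConj cs, signedConj_isLiftable cs⟩ y (t, 0))).2 = _
  rw [lift_signedConj_apply cs y, lift_signedConj_apply cs x, zero_add]

theorem inversionParity_one (t : W) : inversionParity cs 1 t = 0 := by
  classical
  simpa using inversionParity_wordProd cs [] t

open Classical in
theorem inversionParity_simple (i : B) (t : W) :
    inversionParity cs (cs.simple i) t = if t = cs.simple i then 1 else 0 := by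
  have h := inversionParity_wordProd cs [i] t
  rw [wordProd_singleton, rightInvSeq_singleton, List.count_singleton] at h
  rw [h]
  by_cases ht : t = cs.simple i
  · simp [ht]
  · simp [ht, Ne.symm ht]

/-- For `t = u s u⁻¹`, the contributions of `u` and `u⁻¹` in the cocycle rule add up to the parity
of `u u⁻¹ = 1` and cancel; `s` contributes `1`. -/
theorem inversionParity_self {t : W} (ht : cs.IsReflection t) : inversionParity cs t t = 1 := by
  obtain ⟨u, i, rfl⟩ := ht
  have h := inversionParity_mul cs u u⁻¹ (u * cs.simple i * u⁻¹)
  rw [mul_inv_cancel, inversionParity_one] at h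
  rw [inversionParity_mul, inversionParity_mul]
  simp only [mul_assoc, inv_inv, inv_mul_cancel_left, inv_mul_cancel, mul_one, one_mul, inv_simple,
    simple_mul_simple_self, inversionParity_simple, if_true] at h ⊢
  linear_combination -h

theorem mem_rightInvSeq_of_inversionParity_ne_zero {ω : List B} {t : W}
    (h : inversionParity cs (cs.wordProd ω) t ≠ 0) : t ∈ cs.rightInvSeq ω := by
  classical
  by_contra hmem
  rw [inversionParity_wordProd, List.count_eq_zero_of_not_mem hmem, Nat.cast_zero] at h
  exact h rfl

theorem zmod_two_eq_zero_or_one (a : ZMod 2) : a = 0 ∨ a = 1 := by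
  revert a; decide

theorem length_mul_lt_of_inversionParity {w t : W} (h : inversionParity cs w t = 1) :
    cs.length (w * t) < cs.length w := by
  obtain ⟨ω, hω, rfl⟩ := cs.exists_isReduced w
  exact (cs.isRightInversion_of_mem_rightInvSeq hω
    (mem_rightInvSeq_of_inversionParity_ne_zero cs (by simp [h]))).2

/-- If the parity of `w` at `t` is `0`, that of `w t` is `1`, so `w = (w t) t` is shorter than `w
t`. -/
theorem inversionParity_eq_one_iff {w t : W} (ht : cs.IsReflection t) :
    inversionParity cs w t = 1 ↔ cs.length (w * t) < cs.length w := by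
  refine ⟨length_mul_lt_of_inversionParity cs, fun h => ?_⟩
  refine (zmod_two_eq_zero_or_one _).resolve_left fun h0 => ?_
  have h1 : inversionParity cs (w * t) t = 1 := by
    rw [inversionParity_mul, inversionParity_self cs ht, mul_inv_cancel_right, h0, add_zero]
  have h2 := length_mul_lt_of_inversionParity cs h1
  rw [mul_assoc, ht.mul_self, mul_one] at h2
  exact h2.asymm h

/-- The strong exchange property. -/
theorem exists_eraseIdx_of_length_mul_lt (ω : List B) {t : W} (ht : cs.IsReflection t)
    (h : cs.length (cs.wordProd ω * t) < cs.length (cs.wordProd ω)) :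
    ∃ n < ω.length, cs.wordProd ω * t = cs.wordProd (ω.eraseIdx n) := by
  have h1 := (inversionParity_eq_one_iff cs ht).mpr h
  have hmem := mem_rightInvSeq_of_inversionParity_ne_zero cs (h1.trans_ne one_ne_zero)
  obtain ⟨n, hn, rfl⟩ := List.mem_iff_getElem.mp hmem
  refine ⟨n, by simpa using hn, ?_⟩
  rw [← cs.wordProd_mul_getD_rightInvSeq, List.getD_eq_getElem]

/-- The exchange property for a left descent. -/
theorem exists_eraseIdx_of_isLeftDescent (ω : List B) {i : B}
    (h : cs.IsLeftDescent (cs.wordProd ω) i) :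
    ∃ n < ω.length, cs.simple i * cs.wordProd ω = cs.wordProd (ω.eraseIdx n) := by
  have e : cs.wordProd ω * ((cs.wordProd ω)⁻¹ * cs.simple i * cs.wordProd ω) =
      cs.simple i * cs.wordProd ω := by group
  have ht : cs.IsReflection ((cs.wordProd ω)⁻¹ * cs.simple i * cs.wordProd ω) :=
    ⟨(cs.wordProd ω)⁻¹, i, by simp⟩
  rw [← e]
  refine exists_eraseIdx_of_length_mul_lt cs ω ht ?_
  rwa [e]

/-- Left descents of `w` and `w s_j` agree, unless `s_i w = w s_j`. -/
theorem isLeftDescent_mul_simple_iff {w : W} {i j : B}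
    (h : cs.simple i * w ≠ w * cs.simple j) :
    cs.IsLeftDescent (w * cs.simple j) i ↔ cs.IsLeftDescent w i := by
  classical
  rw [← cs.isRightDescent_inv_iff, ← cs.isRightDescent_inv_iff, IsRightDescent, IsRightDescent,
    ← inversionParity_eq_one_iff cs (cs.isReflection_simple i),
    ← inversionParity_eq_one_iff cs (cs.isReflection_simple i), mul_inv_rev, inv_simple,
    inversionParity_mul, inversionParity_simple, if_neg, add_zero]
  intro h'
  apply h
  rw [inv_inv, mul_assoc, inv_mul_eq_iff_eq_mul] at h'
  exact h'

/-- A reflection occurring exactly once has odd parity. As parity depends only on the group element,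
it also occurs in the inversion sequence of a reduced word; the lengths are then compared. -/
theorem isReduced_of_nodup_rightInvSeq {ω : List B} (h : (cs.rightInvSeq ω).Nodup) :
    cs.IsReduced ω := by
  classical
  obtain ⟨ω', hω', e⟩ := cs.exists_isReduced (cs.wordProd ω)
  have hsub : cs.rightInvSeq ω ⊆ cs.rightInvSeq ω' := by
    intro t ht
    apply mem_rightInvSeq_of_inversionParity_ne_zero
    rw [← e, inversionParity_wordProd, List.count_eq_one_of_mem h ht]
    simp
  have hlen := (h.subperm hsub).length_le
  rw [cs.length_rightInvSeq, cs.length_rightInvSeq] at hlen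
  refine le_antisymm (cs.length_wordProd_le ω) ?_
  rwa [e, hω'.eq]

theorem drop_alternatingWord (i j : B) (k m : ℕ) :
    (alternatingWord i j (k + m)).drop k = alternatingWord i j m := by
  induction k with
  | zero => simp
  | succ k ih => rw [add_right_comm, alternatingWord_succ', List.drop_succ_cons, ih]

/-- The inversions are `s_j (s_i s_j)^k` for `k < m`, which are distinct by the lower bound on the
order of `s_i s_j`. -/
theorem isReduced_alternatingWord {i j : B} (hij : i ≠ j) {m : ℕ} (hm : M i j ≠ 0 → m ≤ M i j) :
    cs.IsReduced (alternatingWord i j m) := by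
  have hrev : (alternatingWord j i (2 * m)).reverse = alternatingWord i j (2 * m) := by
    rw [reverse_alternatingWord, if_pos (even_two_mul _)]
  have hris : cs.rightInvSeq (alternatingWord i j m) =
      ((cs.leftInvSeq (alternatingWord j i (2 * m))).take m).reverse := by
    rw [← drop_alternatingWord i j m m, ← two_mul, cs.rightInvSeq_drop, ← hrev,
      cs.rightInvSeq_reverse, List.drop_reverse, cs.length_leftInvSeq, length_alternatingWord]
    congr 2
    omega
  have helt : ∀ k < m, cs.wordProd (alternatingWord i j (2 * k + 1)) =
      cs.simple j * (cs.simple i * cs.simple j) ^ k := by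
    intro k _
    have e : (2 * k + 1) / 2 = k := by omega
    rw [cs.prod_alternatingWord_eq_mul_pow, if_neg (by simp), e]
  refine isReduced_of_nodup_rightInvSeq cs ?_
  rw [hris, List.nodup_reverse, List.nodup_iff_injective_getElem]
  have key : ∀ k l, k < l → l < m →
      (cs.simple i * cs.simple j) ^ k ≠ (cs.simple i * cs.simple j) ^ l := by
    intro k l hkl hl h
    obtain ⟨d, rfl⟩ := Nat.exists_eq_add_of_lt hkl
    rw [add_assoc, pow_add] at h
    refine simple_mul_simple_pow_ne_one cs hij (Nat.succ_pos d) (fun h0 => ?_)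
      (mul_eq_left.mp h.symm)
    have := hm h0
    omega
  rintro ⟨k, hk⟩ ⟨l, hl⟩ h
  have hk' : k < m := by
    rw [List.length_take] at hk
    omega
  have hl' : l < m := by
    rw [List.length_take] at hl
    omega
  simp only [List.getElem_take] at h
  rw [cs.getElem_leftInvSeq_alternatingWord j i m k (by omega),
    cs.getElem_leftInvSeq_alternatingWord j i m l (by omega), helt k hk', helt l hl',
    mul_right_inj] at h
  rcases lt_trichotomy k l with hkl | hkl | hkl
  · exact absurd h (key k l hkl hl')
  · exact Fin.ext hkl
  · exact absurd h.symm (key l k hkl hk')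

end Inversions

/-! ### Matsumoto's theorem -/

section Matsumoto

theorem isReduced_of_cons {i : B} {ω : List B} (h : cs.IsReduced (i :: ω)) : cs.IsReduced ω := by
  simpa using h.drop 1

/-- The alternating word of length `m` that starts with `i`. -/
def altWord (i j : B) : ℕ → List B
  | 0 => []
  | m + 1 => i :: altWord j i m

theorem length_altWord (i j : B) (m : ℕ) : (altWord i j m).length = m := by
  induction m generalizing i j with
  | zero => rfl
  | succ m ih => simp [altWord, ih]

/-- `alternatingWord` fixes the last letter and `altWord` the first, hence the dependence on parity.
-/
theorem altWord_eq_alternatingWord (i j : B) (m : ℕ) :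
    altWord i j m = if Even m then alternatingWord i j m else alternatingWord j i m := by
  induction m generalizing i j with
  | zero => rfl
  | succ m ih =>
    rw [altWord, ih, alternatingWord_succ' i j, alternatingWord_succ' j i]
    by_cases h : Even m <;> simp [h, Nat.even_add_one]

theorem isReduced_altWord {i j : B} (hij : i ≠ j) {m : ℕ} (hm : M i j ≠ 0 → m ≤ M i j) :
    cs.IsReduced (altWord i j m) := by
  rw [altWord_eq_alternatingWord]
  split_ifs
  · exact isReduced_alternatingWord cs hij hm
  · exact isReduced_alternatingWord cs hij.symm (by rwa [M.symmetric j i])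

/-- An element with two distinct left descents `i`, `j` has a reduced word that starts with any
alternating word in `i`, `j` of length at most `M i j`. -/
theorem exists_isReduced_altWord_append {i j : B} (hij : i ≠ j) {w : W}
    (hi : cs.IsLeftDescent w i) (hj : cs.IsLeftDescent w j) (m : ℕ)
    (hm : M i j ≠ 0 → m ≤ M i j) :
    ∃ β, cs.IsReduced (altWord i j m ++ β) ∧ cs.wordProd (altWord i j m ++ β) = w := by
  induction m generalizing i j with
  | zero =>
    obtain ⟨ω, hω, e⟩ := cs.exists_isReduced w
    exact ⟨ω, hω, e.symm⟩
  | succ m ih =>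
    obtain ⟨β, hβ, e⟩ := ih hij.symm hj hi (by
      intro h0
      rw [M.symmetric j i] at h0 ⊢
      have := hm h0
      omega)
    have hi' := hi
    rw [← e] at hi'
    obtain ⟨n, hn, hex⟩ := exists_eraseIdx_of_isLeftDescent cs _ hi'
    rw [List.length_append] at hn
    -- The exchanged letter cannot lie in the alternating prefix: the alternating word of length `m
    -- + 1` would then have a shorter expression, although it is reduced.
    rcases Nat.lt_or_ge n (altWord j i m).length with hlt | hge
    · exfalso
      rw [List.eraseIdx_append_of_lt_length hlt, wordProd_append, wordProd_append, ← mul_assoc,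
        mul_left_inj, ← wordProd_cons] at hex
      have hred : cs.IsReduced (altWord i j (m + 1)) := isReduced_altWord cs hij hm
      have h1 := hred.eq
      rw [altWord, hex] at h1
      have h2 := cs.length_wordProd_le ((altWord j i m).eraseIdx n)
      have h3 := List.length_eraseIdx_add_one hlt
      rw [h1, List.length_cons] at h2
      omega
    · rw [List.eraseIdx_append_of_length_le hge] at hex
      set β' := β.eraseIdx (n - (altWord j i m).length) with hβ'
      have hprod : cs.wordProd (altWord i j (m + 1) ++ β') = w := by
        rw [altWord, List.cons_append, wordProd_cons, ← hex, e, simple_mul_simple_cancel_left]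
      refine ⟨β', ?_, hprod⟩
      have h3 : β'.length + 1 = β.length := List.length_eraseIdx_add_one (by omega)
      rw [CoxeterSystem.IsReduced, hprod, ← e, hβ.eq, List.length_append, List.length_append,
        length_altWord, length_altWord]
      omega

theorem isLeftDescent_of_isReduced_cons {i : B} {ω : List B} (h : cs.IsReduced (i :: ω)) :
    cs.IsLeftDescent (cs.wordProd (i :: ω)) i := by
  rw [IsLeftDescent, h.eq, wordProd_cons, simple_mul_simple_cancel_left,
    (isReduced_of_cons cs h).eq]
  simp

/-- Matsumoto's theorem: a map to a monoid that satisfies the braid relations takes the same value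
on all reduced words of an element. -/
theorem prod_map_eq_of_isReduced {G : Type*} [Monoid G] (f : B → G)
    (hf : ∀ i j, ((braidWord M i j).map f).prod = ((braidWord M j i).map f).prod)
    {ω ω' : List B} (hω : cs.IsReduced ω) (hω' : cs.IsReduced ω')
    (h : cs.wordProd ω = cs.wordProd ω') : (ω.map f).prod = (ω'.map f).prod := by
  have hf' : ∀ i j, ((altWord i j (M i j)).map f).prod = ((altWord j i (M i j)).map f).prod := by
    intro i j
    have h1 := hf i j
    rw [braidWord, braidWord, M.symmetric j i] at h1
    rw [altWord_eq_alternatingWord, altWord_eq_alternatingWord]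
    split_ifs
    · exact h1
    · exact h1.symm
  induction hn : ω.length generalizing ω ω' with
  | zero =>
    have hn' : ω'.length = 0 := by rw [← hω'.eq, ← h, hω.eq, hn]
    rw [List.length_eq_zero_iff.mp hn, List.length_eq_zero_iff.mp hn']
  | succ n ih =>
    have step : ∀ {k : B} {α α' : List B}, cs.IsReduced (k :: α) → cs.IsReduced (k :: α') →
        cs.wordProd (k :: α) = cs.wordProd (k :: α') → (k :: α).length = n + 1 →
        ((k :: α).map f).prod = ((k :: α').map f).prod := by
      intro k α α' h1 h2 h3 h4
      rw [wordProd_cons, wordProd_cons, mul_right_inj] at h3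
      rw [List.map_cons, List.map_cons, List.prod_cons, List.prod_cons,
        ih (isReduced_of_cons cs h1) (isReduced_of_cons cs h2) h3 (by simpa using h4)]
    have hn' : ω'.length = n + 1 := by rw [← hω'.eq, ← h, hω.eq, hn]
    obtain ⟨i, α, rfl⟩ := List.exists_cons_of_length_eq_add_one hn
    obtain ⟨j, α', rfl⟩ := List.exists_cons_of_length_eq_add_one hn'
    by_cases hij : i = j
    · subst hij
      exact step hω hω' h hn
    have hi := isLeftDescent_of_isReduced_cons cs hω
    have hj := isLeftDescent_of_isReduced_cons cs hω'
    rw [← h] at hj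
    -- For `m = ∞` there would be a reduced word with an alternating prefix longer than the length
    -- of the element.
    have hm0 : M i j ≠ 0 := by
      intro h0
      obtain ⟨β, hβ, e⟩ := exists_isReduced_altWord_append cs hij hi hj (n + 2)
        (fun h => absurd h0 h)
      have := hβ.eq
      rw [e, hω.eq, List.length_append, length_altWord] at this
      omega
    obtain ⟨m, hm⟩ := Nat.exists_eq_succ_of_ne_zero hm0
    obtain ⟨β, hβ, e⟩ := exists_isReduced_altWord_append cs hij hi hj (M i j) (fun _ => le_rfl)
    have hpq : cs.wordProd (altWord i j (M i j)) = cs.wordProd (altWord j i (M i j)) := by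
      have h1 := cs.wordProd_braidWord_eq i j
      rw [braidWord, braidWord, M.symmetric j i] at h1
      rw [altWord_eq_alternatingWord, altWord_eq_alternatingWord]
      split_ifs
      · exact h1
      · exact h1.symm
    have e' : cs.wordProd (altWord j i (M i j) ++ β) = cs.wordProd (i :: α) := by
      rw [wordProd_append, ← hpq, ← wordProd_append, e]
    have hβ' : cs.IsReduced (altWord j i (M i j) ++ β) := by
      rw [CoxeterSystem.IsReduced, e', ← e, hβ.eq]
      simp [length_altWord]
    -- The two words are linked through words that begin with the two sides of the braid relation;
    -- each comparison is between words with the same first letter.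
    have h1 : ((i :: α).map f).prod = ((altWord i j (M i j) ++ β).map f).prod := by
      rw [hm, altWord, List.cons_append] at hβ e ⊢
      exact step hω hβ e.symm hn
    have h2 : ((j :: α').map f).prod = ((altWord j i (M i j) ++ β).map f).prod := by
      rw [hm, altWord, List.cons_append] at hβ' e' ⊢
      exact step hω' hβ' (h.symm.trans e'.symm) hn'
    rw [h1, h2, List.map_append, List.map_append, List.prod_append, List.prod_append, hf']

end Matsumoto

/-! ### The Bruhat order by subwords and by chains of reflections -/

section Bruhat

/-- If `i` is a left descent of a reduced word, then deleting one letter gives a reduced word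
of `s_i w`. -/
theorem exists_sublist_of_isLeftDescent {ω : List B} (hω : cs.IsReduced ω) {i : B}
    (h : cs.IsLeftDescent (cs.wordProd ω) i) :
    ∃ ω' : List B, ω'.Sublist ω ∧ cs.IsReduced ω' ∧
      cs.wordProd ω' = cs.simple i * cs.wordProd ω := by
  obtain ⟨n, hn, e⟩ := exists_eraseIdx_of_isLeftDescent cs ω h
  refine ⟨ω.eraseIdx n, List.eraseIdx_sublist _ _, ?_, e.symm⟩
  have h1 := cs.isLeftDescent_iff.mp h
  have h2 := List.length_eraseIdx_add_one hn
  rw [hω.eq, e] at h1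
  rw [CoxeterSystem.IsReduced]
  omega

theorem isReduced_cons_iff {i : B} {ω : List B} (hω : cs.IsReduced ω) :
    cs.IsReduced (i :: ω) ↔ ¬ cs.IsLeftDescent (cs.wordProd ω) i := by
  rw [cs.not_isLeftDescent_iff, CoxeterSystem.IsReduced, wordProd_cons, hω.eq, List.length_cons]

/-- The deletion property: every word contains a reduced word of the same element. -/
theorem exists_isReduced_sublist (ω : List B) :
    ∃ ω' : List B, ω'.Sublist ω ∧ cs.IsReduced ω' ∧ cs.wordProd ω' = cs.wordProd ω := by
  induction ω with
  | nil => exact ⟨[], List.Sublist.refl _, by simp [CoxeterSystem.IsReduced], rfl⟩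
  | cons i ω ih =>
    obtain ⟨ω', hsub, hred, e⟩ := ih
    rw [wordProd_cons, ← e]
    by_cases h : cs.IsLeftDescent (cs.wordProd ω') i
    · obtain ⟨ω'', hsub', hred', e'⟩ := exists_sublist_of_isLeftDescent cs hred h
      exact ⟨ω'', (hsub'.trans hsub).cons i, hred', e'⟩
    · exact ⟨i :: ω', hsub.cons_cons i, (isReduced_cons_iff cs hred).mpr h, wordProd_cons cs i ω'⟩

/-- One step of the strong Bruhat order: `w` is obtained from `u` by a reflection that increases
the length. -/
def BruhatStep (u w : W) : Prop :=
  ∃ t, cs.IsReflection t ∧ w * t = u ∧ cs.length u < cs.length w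

theorem bruhatStep_simple_mul {w : W} {i : B} (h : ¬ cs.IsLeftDescent w i) :
    BruhatStep cs w (cs.simple i * w) := by
  refine ⟨w⁻¹ * cs.simple i * w, ⟨w⁻¹, i, by simp⟩, ?_, ?_⟩
  · simp [mul_assoc]
  · rw [cs.not_isLeftDescent_iff.mp h]
    exact Nat.lt_succ_self _

/-- By the cocycle rule, `w` and `s_i w` have the same parity at `t` unless `w t w⁻¹ = s_i`, which
is the exceptional case. -/
theorem BruhatStep.simple_mul {u w : W} (h : BruhatStep cs u w) (i : B) :
    BruhatStep cs (cs.simple i * u) (cs.simple i * w) ∨ cs.simple i * u = w := by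
  classical
  obtain ⟨t, ht, rfl, hlt⟩ := h
  by_cases hi : w * t * w⁻¹ = cs.simple i
  · right
    rw [← hi, mul_assoc, inv_mul_cancel_left, mul_assoc, ht.mul_self, mul_one]
  · left
    refine ⟨t, ht, mul_assoc _ _ _, ?_⟩
    rw [← mul_assoc, ← inversionParity_eq_one_iff cs ht, inversionParity_mul,
      inversionParity_simple, if_neg hi, add_zero, inversionParity_eq_one_iff cs ht]
    exact hlt

theorem reflTransGen_bruhatStep_simple_mul {u w : W}
    (h : Relation.ReflTransGen (BruhatStep cs) u w) (i : B) :
    Relation.ReflTransGen (BruhatStep cs) (cs.simple i * u) w ∨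
      Relation.ReflTransGen (BruhatStep cs) (cs.simple i * u) (cs.simple i * w) := by
  induction h with
  | refl => exact Or.inr .refl
  | tail _ hstep ih =>
    rcases ih with ih | ih
    · exact Or.inl (ih.tail hstep)
    · rcases hstep.simple_mul cs i with h | h
      · exact Or.inr (ih.tail h)
      · exact Or.inl (h ▸ ih)

theorem reflTransGen_bruhatStep_of_sublist {ω ω' : List B} (hω : cs.IsReduced ω)
    (hsub : ω'.Sublist ω) :
    Relation.ReflTransGen (BruhatStep cs) (cs.wordProd ω') (cs.wordProd ω) := by
  induction hsub with
  | slnil => exact .refl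
  | cons i _ ih =>
    have hred := isReduced_of_cons cs hω
    rw [wordProd_cons]
    exact (ih hred).tail (bruhatStep_simple_mul cs ((isReduced_cons_iff cs hred).mp hω))
  | cons_cons i _ ih =>
    have hred := isReduced_of_cons cs hω
    rw [wordProd_cons, wordProd_cons]
    rcases reflTransGen_bruhatStep_simple_mul cs (ih hred) i with h | h
    · exact h.tail (bruhatStep_simple_mul cs ((isReduced_cons_iff cs hred).mp hω))
    · exact h

/-- Strong exchange deletes one letter for each step down. It holds for arbitrary words, so the
intermediate subwords need not be reduced. -/
theorem exists_sublist_of_reflTransGen_bruhatStep {u : W} {ω : List B}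
    (h : Relation.ReflTransGen (BruhatStep cs) u (cs.wordProd ω)) :
    ∃ ω' : List B, ω'.Sublist ω ∧ cs.wordProd ω' = u := by
  induction h using Relation.ReflTransGen.head_induction_on with
  | refl => exact ⟨ω, .refl _, rfl⟩
  | head hstep _ ih =>
    obtain ⟨ω', hsub, rfl⟩ := ih
    obtain ⟨t, ht, rfl, hlt⟩ := hstep
    obtain ⟨n, _, e⟩ := exists_eraseIdx_of_length_mul_lt cs ω' ht hlt
    exact ⟨ω'.eraseIdx n, (List.eraseIdx_sublist _ _).trans hsub, e.symm⟩

/-- Chains make transitivity evident and show that any reduced word of `w` may be used for the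
subwords. -/
theorem bruhatLE_iff_reflTransGen {u w : W} :
    BruhatLE cs u w ↔ Relation.ReflTransGen (BruhatStep cs) u w := by
  constructor
  · rintro ⟨ω, hω, rfl, ω', hsub, _, rfl⟩
    exact reflTransGen_bruhatStep_of_sublist cs hω hsub
  · intro h
    obtain ⟨ω, hω, rfl⟩ := cs.exists_isReduced w
    obtain ⟨ω', hsub, rfl⟩ := exists_sublist_of_reflTransGen_bruhatStep cs h
    obtain ⟨ω'', hsub', hred, e⟩ := exists_isReduced_sublist cs ω'
    exact ⟨ω, hω, rfl, ω'', hsub'.trans hsub, hred, e⟩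

variable {cs}

theorem BruhatLE.trans {x y z : W} (h : BruhatLE cs x y) (h' : BruhatLE cs y z) :
    BruhatLE cs x z := by
  rw [bruhatLE_iff_reflTransGen] at h h' ⊢
  exact h.trans h'

theorem BruhatLT.length_lt {x y : W} (h : BruhatLT cs x y) : cs.length x < cs.length y := by
  obtain ⟨⟨ω, hω, rfl, ω', hsub, hω', rfl⟩, hne⟩ := h
  rw [hω.eq, hω'.eq]
  refine lt_of_le_of_ne hsub.length_le fun hlen => hne ?_
  rw [hsub.eq_of_length hlen]

theorem BruhatLT.trans {x y z : W} (h : BruhatLT cs x y) (h' : BruhatLT cs y z) :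
    BruhatLT cs x z := by
  refine ⟨h.1.trans h'.1, ?_⟩
  rintro rfl
  exact h.length_lt.asymm h'.length_lt

theorem bruhatLT_simple_mul {y : W} {i : B} (hy : ¬ cs.IsLeftDescent y i) :
    BruhatLT cs y (cs.simple i * y) := by
  refine ⟨(bruhatLE_iff_reflTransGen cs).mpr (.single (bruhatStep_simple_mul cs hy)), fun h => ?_⟩
  have := cs.not_isLeftDescent_iff.mp hy
  rw [← h] at this
  omega

theorem BruhatLT.simple_mul {x y : W} {i : B} (h : BruhatLT cs x y) (hy : ¬ cs.IsLeftDescent y i) :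
    BruhatLT cs (cs.simple i * x) (cs.simple i * y) := by
  refine ⟨?_, fun e => h.2 (mul_left_cancel e)⟩
  have h1 := (bruhatLE_iff_reflTransGen cs).mp h.1
  rw [bruhatLE_iff_reflTransGen]
  rcases reflTransGen_bruhatStep_simple_mul cs h1 i with h2 | h2
  · exact h2.tail (bruhatStep_simple_mul cs hy)
  · exact h2

end Bruhat

/-! ### The regular representation -/

section RegularRepresentation

open Classical in
/-- Left multiplication by `h_s` on the free module on `W`. -/
def leftOp (i : B) : Module.End ℤ[T;T⁻¹] (W →₀ ℤ[T;T⁻¹]) :=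
  Finsupp.linearCombination ℤ[T;T⁻¹] fun x =>
    Finsupp.single (cs.simple i * x) 1 +
      (if cs.IsLeftDescent x i then vInv - v else 0) • Finsupp.single x 1

open Classical in
/-- Right multiplication by `h_s` on the free module on `W`. -/
def rightOp (i : B) : Module.End ℤ[T;T⁻¹] (W →₀ ℤ[T;T⁻¹]) :=
  Finsupp.linearCombination ℤ[T;T⁻¹] fun x =>
    Finsupp.single (x * cs.simple i) 1 +
      (if cs.IsRightDescent x i then vInv - v else 0) • Finsupp.single x 1

open Classical in
theorem leftOp_single (i : B) (x : W) : leftOp cs i (Finsupp.single x 1) =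
    Finsupp.single (cs.simple i * x) 1 +
      (if cs.IsLeftDescent x i then vInv - v else 0) • Finsupp.single x 1 := by
  rw [leftOp, Finsupp.linearCombination_single, one_smul]

open Classical in
theorem rightOp_single (i : B) (x : W) : rightOp cs i (Finsupp.single x 1) =
    Finsupp.single (x * cs.simple i) 1 +
      (if cs.IsRightDescent x i then vInv - v else 0) • Finsupp.single x 1 := by
  rw [rightOp, Finsupp.linearCombination_single, one_smul]

theorem end_ext_single {X : Type*} {f g : Module.End ℤ[T;T⁻¹] (X →₀ ℤ[T;T⁻¹])}
    (h : ∀ x : X, f (Finsupp.single x 1) = g (Finsupp.single x 1)) : f = g :=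
  Finsupp.lhom_ext' fun x => LinearMap.ext_ring (h x)

theorem leftOp_mul_leftOp (i : B) :
    leftOp cs i * leftOp cs i = (vInv - v) • leftOp cs i + 1 := by
  refine end_ext_single fun x => ?_
  have h := cs.isLeftDescent_iff_not_isLeftDescent_mul (w := x) (i := i)
  simp only [Module.End.mul_apply, LinearMap.add_apply, LinearMap.smul_apply, leftOp_single,
    map_add, map_smul, simple_mul_simple_cancel_left, Module.End.one_apply]
  by_cases hx : cs.IsLeftDescent x i
  · have hx' := h.mp hx
    simp only [hx, hx', if_true, if_false]
    module
  · have hx' := not_not.mp (mt h.mpr hx)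
    simp only [hx, hx', if_true, if_false]
    module

/-- Right descents of `w` and `s_i w` agree, unless `s_i w = w s_j`. -/
theorem isRightDescent_simple_mul_iff {w : W} {i j : B}
    (h : cs.simple i * w ≠ w * cs.simple j) :
    cs.IsRightDescent (cs.simple i * w) j ↔ cs.IsRightDescent w j := by
  rw [← cs.isLeftDescent_inv_iff, ← cs.isLeftDescent_inv_iff, mul_inv_rev, inv_simple]
  refine isLeftDescent_mul_simple_iff cs fun h' => h ?_
  simpa using (congrArg (·⁻¹) h').symm

/-- If `s_i x ≠ x s_j`, multiplication on one side does not affect descents on the other. If they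
are equal, `i` is a left descent of `x` exactly when `j` is a right descent, and the correction
terms match. -/
theorem leftOp_commute_rightOp (i j : B) : Commute (leftOp cs i) (rightOp cs j) := by
  classical
  refine end_ext_single fun x => ?_
  simp only [Module.End.mul_apply, leftOp_single, rightOp_single, map_add, map_smul, mul_assoc]
  by_cases h : cs.simple i * x = x * cs.simple j
  · have e1 : cs.IsLeftDescent (x * cs.simple j) i ↔ ¬ cs.IsLeftDescent x i := by
      rw [← h, cs.isLeftDescent_iff_not_isLeftDescent_mul (w := x), not_not]
    have e2 : cs.IsRightDescent (x * cs.simple j) j ↔ ¬ cs.IsRightDescent x j := by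
      rw [cs.isRightDescent_iff_not_isRightDescent_mul (w := x), not_not]
    have e3 : cs.IsLeftDescent x i ↔ cs.IsRightDescent x j := by
      rw [IsLeftDescent, IsRightDescent, h]
    by_cases hx : cs.IsRightDescent x j
    · simp only [e1, e2, e3, hx, h, not_true, if_true, if_false]
    · simp only [e1, e2, e3, hx, h, not_false_eq_true, if_true, if_false]
  · simp only [isLeftDescent_mul_simple_iff cs h, isRightDescent_simple_mul_iff cs h]
    module

theorem prod_map_leftOp_single_one {ω : List B} (hω : cs.IsReduced ω) :
    (ω.map (leftOp cs)).prod (Finsupp.single 1 1) = Finsupp.single (cs.wordProd ω) 1 := by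
  induction ω with
  | nil => simp
  | cons i ω ih =>
    have hred := isReduced_of_cons cs hω
    rw [List.map_cons, List.prod_cons, Module.End.mul_apply, ih hred, leftOp_single,
      if_neg ((isReduced_cons_iff cs hred).mp hω), zero_smul, add_zero, wordProd_cons]

/-- The right operators reach every basis vector from the one at `1`. -/
theorem end_ext_of_commute_rightOp {f g : Module.End ℤ[T;T⁻¹] (W →₀ ℤ[T;T⁻¹])}
    (hf : ∀ i, Commute f (rightOp cs i)) (hg : ∀ i, Commute g (rightOp cs i))
    (h : f (Finsupp.single 1 1) = g (Finsupp.single 1 1)) : f = g := by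
  refine end_ext_single fun x => ?_
  induction hn : cs.length x generalizing x with
  | zero => rwa [cs.length_eq_zero_iff.mp hn]
  | succ n ih =>
    obtain ⟨i, hi⟩ := cs.exists_rightDescent_of_ne_one (w := x) (by rintro rfl; simp at hn)
    have hi' := cs.isRightDescent_iff_not_isRightDescent_mul.mp hi
    have e : (Finsupp.single x 1 : W →₀ ℤ[T;T⁻¹]) =
        rightOp cs i (Finsupp.single (x * cs.simple i) 1) := by
      rw [rightOp_single, if_neg hi', zero_smul, add_zero, simple_mul_simple_cancel_right]
    have hlen := cs.isRightDescent_iff.mp hi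
    rw [e, ← Module.End.mul_apply, ← Module.End.mul_apply, (hf i).eq, (hg i).eq,
      Module.End.mul_apply, Module.End.mul_apply, ih _ (by omega)]

/-- No rank two computation is needed: both sides commute with the right operators, and they agree
on the vector at `1` because both braid words are reduced words of one element. -/
theorem prod_map_leftOp_braidWord (i j : B) :
    ((braidWord M i j).map (leftOp cs)).prod = ((braidWord M j i).map (leftOp cs)).prod := by
  by_cases hij : i = j
  · rw [hij]
  have hcomm : ∀ (ω : List B) (k : B), Commute (ω.map (leftOp cs)).prod (rightOp cs k) := by
    intro ω k
    refine Commute.list_prod_left _ _ fun f hf => ?_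
    obtain ⟨l, _, rfl⟩ := List.mem_map.mp hf
    exact leftOp_commute_rightOp cs l k
  refine end_ext_of_commute_rightOp cs (hcomm _) (hcomm _) ?_
  rw [prod_map_leftOp_single_one cs (isReduced_alternatingWord cs hij fun _ => le_rfl),
    prod_map_leftOp_single_one cs (isReduced_alternatingWord cs (Ne.symm hij) fun _ => le_rfl)]
  exact congrArg (Finsupp.single · 1) (cs.wordProd_braidWord_eq i j)

/-- The left regular representation of the Hecke algebra on the free module on `W`. -/
def regularRep : Hecke M →ₐ[ℤ[T;T⁻¹]] Module.End ℤ[T;T⁻¹] (W →₀ ℤ[T;T⁻¹]) :=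
  RingQuot.liftAlgHom ℤ[T;T⁻¹] ⟨FreeAlgebra.lift ℤ[T;T⁻¹] (leftOp cs), by
    intro a b h
    cases h with
    | quadratic i =>
      simp only [map_mul, map_add, map_smul, map_one, FreeAlgebra.lift_ι_apply]
      exact leftOp_mul_leftOp cs i
    | braid i j =>
      have e : (FreeAlgebra.lift ℤ[T;T⁻¹] (leftOp cs) : FreeAlgebra ℤ[T;T⁻¹] B → _) ∘
          FreeAlgebra.ι ℤ[T;T⁻¹] = leftOp cs := FreeAlgebra.ι_comp_lift (leftOp cs)
      rw [map_list_prod, map_list_prod, List.map_map, List.map_map, e]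
      exact prod_map_leftOp_braidWord cs i j⟩

theorem regularRep_gen (i : B) : regularRep cs (gen M i) = leftOp cs i := by
  rw [regularRep, gen, RingQuot.liftAlgHom_mkAlgHom_apply, FreeAlgebra.lift_ι_apply]

end RegularRepresentation

/-! ### The standard basis -/

section StandardBasis

theorem wordElt_cons (i : B) (ω : List B) : wordElt M (i :: ω) = gen M i * wordElt M ω := by
  simp [wordElt]

theorem wordElt_eq_stdElt {ω : List B} (hω : cs.IsReduced ω) :
    wordElt M ω = stdElt cs (cs.wordProd ω) := by
  obtain ⟨h1, h2⟩ := (cs.exists_isReduced (cs.wordProd ω)).choose_spec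
  exact prod_map_eq_of_isReduced cs (gen M) (wordElt_braidWord M) hω h1 h2

theorem stdElt_one : stdElt cs 1 = 1 := by
  have h := wordElt_eq_stdElt cs (ω := []) (by simp [CoxeterSystem.IsReduced])
  rw [wordProd_nil] at h
  rw [← h]
  simp [wordElt]

theorem gen_mul_stdElt_of_not_isLeftDescent {x : W} {i : B} (h : ¬ cs.IsLeftDescent x i) :
    gen M i * stdElt cs x = stdElt cs (cs.simple i * x) := by
  obtain ⟨ω, hω, rfl⟩ := cs.exists_isReduced x
  rw [← wordElt_eq_stdElt cs hω, ← wordElt_cons,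
    wordElt_eq_stdElt cs ((isReduced_cons_iff cs hω).mpr h), wordProd_cons]

theorem gen_mul_stdElt_of_isLeftDescent {x : W} {i : B} (h : cs.IsLeftDescent x i) :
    gen M i * stdElt cs x = stdElt cs (cs.simple i * x) + (vInv - v) • stdElt cs x := by
  have h' := gen_mul_stdElt_of_not_isLeftDescent cs
    (cs.isLeftDescent_iff_not_isLeftDescent_mul.mp h)
  rw [simple_mul_simple_cancel_left] at h'
  rw [← h', ← mul_assoc, gen_mul_gen, add_mul, one_mul, smul_mul_assoc, add_comm]

theorem regularRep_stdElt_single_one (x : W) :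
    regularRep cs (stdElt cs x) (Finsupp.single 1 1) = Finsupp.single x 1 := by
  obtain ⟨ω, hω, rfl⟩ := cs.exists_isReduced x
  have e : (regularRep cs : Hecke M → _) ∘ gen M = leftOp cs := funext (regularRep_gen cs)
  rw [← wordElt_eq_stdElt cs hω, wordElt, map_list_prod, List.map_map, e,
    prod_map_leftOp_single_one cs hω]

theorem hecke_induction {p : Hecke M → Prop} (halg : ∀ c, p (algebraMap ℤ[T;T⁻¹] (Hecke M) c))
    (hgen : ∀ i, p (gen M i)) (hmul : ∀ a b, p a → p b → p (a * b))
    (hadd : ∀ a b, p a → p b → p (a + b)) (a : Hecke M) : p a := by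
  obtain ⟨a, rfl⟩ := RingQuot.mkAlgHom_surjective ℤ[T;T⁻¹] (HeckeRel M) a
  induction a with
  | grade0 c => simpa using halg c
  | grade1 i => exact hgen i
  | mul a b ha hb => simpa using hmul _ _ ha hb
  | add a b ha hb => simpa using hadd _ _ ha hb

/-- At the basis vector of `1` this shows that `e_x ↦ h_x` is a left inverse of `a ↦ a · e_1`, so
the `h_x` span. -/
theorem linearCombination_stdElt_regularRep (a : Hecke M) (f : W →₀ ℤ[T;T⁻¹]) :
    Finsupp.linearCombination ℤ[T;T⁻¹] (stdElt cs) (regularRep cs a f) =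
      a * Finsupp.linearCombination ℤ[T;T⁻¹] (stdElt cs) f := by
  induction a using hecke_induction generalizing f with
  | halg c => simp [Algebra.smul_def]
  | hgen i =>
    rw [regularRep_gen]
    induction f using Finsupp.induction_linear with
    | zero => simp
    | add f g hf hg => rw [map_add, map_add, map_add, hf, hg, mul_add]
    | single x c =>
      rw [← mul_one c, ← smul_eq_mul, ← Finsupp.smul_single, map_smul, map_smul, map_smul,
        mul_smul_comm, leftOp_single]
      congr 1
      simp only [map_add, map_smul, Finsupp.linearCombination_single, one_smul]
      split_ifs with h
      · rw [gen_mul_stdElt_of_isLeftDescent cs h]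
      · rw [gen_mul_stdElt_of_not_isLeftDescent cs h, zero_smul, add_zero]
  | hmul a b ha hb => rw [map_mul, Module.End.mul_apply, ha, hb, mul_assoc]
  | hadd a b ha hb => rw [map_add, LinearMap.add_apply, map_add, ha, hb, add_mul]

/-- The standard basis `(h_x)` of the Hecke algebra. -/
def stdBasis : Module.Basis W ℤ[T;T⁻¹] (Hecke M) :=
  .ofRepr <| LinearEquiv.ofLinearMap
    ((LinearMap.applyₗ (Finsupp.single 1 1)).comp (regularRep cs).toLinearMap)
    (Finsupp.linearCombination ℤ[T;T⁻¹] (stdElt cs))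
    (Finsupp.lhom_ext' fun x => LinearMap.ext_ring (by
      simp [regularRep_stdElt_single_one]))
    (LinearMap.ext fun a => by
      simp [linearCombination_stdElt_regularRep, stdElt_one])

theorem stdBasis_apply (x : W) : stdBasis cs x = stdElt cs x := by
  rw [stdBasis, Module.Basis.coe_ofRepr]
  simp

end StandardBasis

/-! ### Laurent polynomials invariant under `v ↦ v⁻¹` -/

section Laurent

theorem v_mul_vInv : v * vInv = 1 := by
  rw [v, vInv, ← LaurentPolynomial.T_add, add_neg_cancel, LaurentPolynomial.T_zero]

theorem invert_v : LaurentPolynomial.invert v = vInv := by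
  simp [v, vInv]

/-- All exponents in `v ℤ[v]` are positive, and `invert` negates them. -/
theorem eq_zero_of_invert_eq_self {p : Polynomial ℤ}
    (h : LaurentPolynomial.invert (v * Polynomial.toLaurent p) = v * Polynomial.toLaurent p) :
    v * Polynomial.toLaurent p = 0 := by
  have hX : v * Polynomial.toLaurent p = Polynomial.toLaurent (Polynomial.X * p) := by
    rw [map_mul, Polynomial.toLaurent_X, v]
  have hpos : ∀ n : ℤ, (v * Polynomial.toLaurent p).coeff n ≠ 0 → 0 < n := by
    intro n hn
    have hmem := Finsupp.mem_support_iff.mpr hn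
    rw [hX, LaurentPolynomial.support_coeff_toLaurent] at hmem
    obtain ⟨k, hk, rfl⟩ := Finset.mem_map.mp hmem
    rw [Polynomial.mem_support_iff] at hk
    rcases k with _ | k
    · simp at hk
    · simp
  refine LaurentPolynomial.ext fun n => ?_
  by_contra hn
  have h1 := hpos n hn
  rw [← h, LaurentPolynomial.invert_apply] at hn
  have h2 := hpos _ hn
  omega

end Laurent

/-- A ring with the structure of the Hecke algebra: a standard basis, generators which act on it by
the usual rules, and a duality. -/
structure HeckeModel (H : Type*) [Ring H] [Algebra ℤ[T;T⁻¹] H] where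
  /-- the generators `h_s` -/
  gen : B → H
  /-- the standard elements `h_x` -/
  std : W → H
  /-- the standard basis -/
  basis : Module.Basis W ℤ[T;T⁻¹] H
  basis_apply : ∀ x, basis x = std x
  /-- the duality -/
  dual : H →+* H
  std_one : std 1 = 1
  gen_mul_of_not : ∀ {x i}, ¬ cs.IsLeftDescent x i → gen i * std x = std (cs.simple i * x)
  gen_mul_of : ∀ {x i}, cs.IsLeftDescent x i →
    gen i * std x = std (cs.simple i * x) + (vInv - v) • std x
  dual_algebraMap : ∀ c, dual (algebraMap ℤ[T;T⁻¹] H c) =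
    algebraMap ℤ[T;T⁻¹] H (LaurentPolynomial.invert c)
  dual_gen : ∀ i, dual (gen i) = gen i + algebraMap ℤ[T;T⁻¹] H (v - vInv)

/-- Every element of positive length is `s_i y` with `y` shorter. -/
theorem exists_simple_mul_eq {x : W} (hx : x ≠ 1) :
    ∃ i y, ¬ cs.IsLeftDescent y i ∧ x = cs.simple i * y := by
  obtain ⟨i, hi⟩ := cs.exists_leftDescent_of_ne_one hx
  exact ⟨i, cs.simple i * x, cs.isLeftDescent_iff_not_isLeftDescent_mul.mp hi, by simp⟩

namespace HeckeModel

variable {cs} {H : Type*} [Ring H] [Algebra ℤ[T;T⁻¹] H] (m : HeckeModel cs H)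

/-- The subgroup `∑_{y ∈ Y} v ℤ[v] h_y`. -/
def vSum (Y : Set W) : AddSubgroup H :=
  AddSubgroup.closure
    {a | ∃ y ∈ Y, ∃ p : Polynomial ℤ, a = (v * Polynomial.toLaurent p) • m.std y}

/-! ### Unitriangular families -/

section Unitriangular

theorem repr_std (x : W) : m.basis.repr (m.std x) = Finsupp.single x 1 := by
  rw [← m.basis_apply, Module.Basis.repr_self]

/-- The span of the `h_y` with `y` of length less than `n`. -/
def lowerSpan (n : ℕ) : Submodule ℤ[T;T⁻¹] (H) :=
  Submodule.span _ (m.std '' {y | cs.length y < n})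

theorem std_mem_lowerSpan {y : W} {n : ℕ} (h : cs.length y < n) :
    m.std y ∈ m.lowerSpan n :=
  Submodule.subset_span ⟨y, h, rfl⟩

theorem lowerSpan_mono {k n : ℕ} (h : k ≤ n) : m.lowerSpan k ≤ m.lowerSpan n :=
  Submodule.span_mono (Set.image_mono fun _ hy => lt_of_lt_of_le hy h)

theorem repr_eq_zero_of_mem_lowerSpan {a : H} {n : ℕ} (h : a ∈ m.lowerSpan n) {x : W}
    (hx : n ≤ cs.length x) : m.basis.repr a x = 0 := by
  induction h using Submodule.span_induction with
  | mem a ha =>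
    obtain ⟨y, hy, rfl⟩ := ha
    have hyx : x ≠ y := by
      rintro rfl
      exact absurd hx (not_le.mpr hy)
    rw [m.repr_std, Finsupp.single_eq_of_ne hyx]
  | zero => simp
  | add a b _ _ ha hb => rw [map_add, Finsupp.add_apply, ha, hb, add_zero]
  | smul c a _ ha => rw [map_smul, Finsupp.smul_apply, ha, smul_zero]

/-- A family in the Hecke algebra is unitriangular if its `x`-th member is `h_x` plus a combination
of `h_y` with `y` shorter than `x`. -/
def IsUnitriangular (f : W → H) : Prop :=
  ∀ x, f x - m.std x ∈ m.lowerSpan (cs.length x)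

/-- The coefficient at a longest element of the support is not changed by a unitriangular
family. -/
theorem repr_linearCombination {f : W → H} (hf : m.IsUnitriangular f)
    (c : W →₀ ℤ[T;T⁻¹]) {x : W} (hx : ∀ y ∈ c.support, cs.length y ≤ cs.length x) :
    m.basis.repr (Finsupp.linearCombination ℤ[T;T⁻¹] f c) x = c x := by
  classical
  have h : ∀ y ∈ c.support, m.basis.repr (c y • f y) x = if y = x then c y else 0 := by
    intro y hy
    have h0 := m.repr_eq_zero_of_mem_lowerSpan (hf y) (hx y hy)
    rw [map_sub, Finsupp.sub_apply, sub_eq_zero] at h0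
    rw [map_smul, Finsupp.smul_apply, h0, m.repr_std, Finsupp.single_apply]
    simp
  rw [Finsupp.linearCombination_apply, Finsupp.sum, map_sum, Finsupp.finsetSum_apply,
    Finset.sum_congr rfl h, Finset.sum_ite_eq']
  simp +contextual

theorem linearIndependent {f : W → H} (hf : m.IsUnitriangular f) :
    LinearIndependent ℤ[T;T⁻¹] f := by
  rw [linearIndependent_iff]
  intro c hc
  by_contra hne
  obtain ⟨x, hx, hmax⟩ := c.support.exists_max_image cs.length
    (Finsupp.support_nonempty_iff.mpr hne)
  have h := m.repr_linearCombination hf c hmax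
  rw [hc, map_zero, Finsupp.zero_apply] at h
  exact Finsupp.mem_support_iff.mp hx h.symm

theorem top_le_span {f : W → H} (hf : m.IsUnitriangular f) :
    ⊤ ≤ Submodule.span ℤ[T;T⁻¹] (Set.range f) := by
  have key : ∀ n, m.lowerSpan n ≤ Submodule.span ℤ[T;T⁻¹] (Set.range f) := by
    intro n
    induction n with
    | zero => simp [lowerSpan]
    | succ n ih =>
      refine Submodule.span_le.mpr ?_
      rintro _ ⟨y, hy, rfl⟩
      have h := ih (m.lowerSpan_mono (Nat.lt_succ_iff.mp hy) (hf y))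
      simpa using sub_mem (Submodule.subset_span (Set.mem_range_self y)) h
  rw [← m.basis.span_eq, Submodule.span_le]
  rintro _ ⟨x, rfl⟩
  rw [m.basis_apply]
  exact key _ (m.std_mem_lowerSpan (Nat.lt_succ_self _))

theorem gen_mul_mem_lowerSpan {a : H} {n : ℕ} (h : a ∈ m.lowerSpan n) (i : B) :
    m.gen i * a ∈ m.lowerSpan (n + 1) := by
  induction h using Submodule.span_induction with
  | mem a ha =>
    obtain ⟨y, hy, rfl⟩ := ha
    have hy' : cs.length y < n := hy
    have hlen : cs.length (cs.simple i * y) < n + 1 := by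
      rcases cs.length_simple_mul y i with h | h <;> omega
    by_cases hi : cs.IsLeftDescent y i
    · rw [m.gen_mul_of hi]
      exact add_mem (m.std_mem_lowerSpan hlen)
        (Submodule.smul_mem _ _ (m.std_mem_lowerSpan (hy'.trans (Nat.lt_succ_self n))))
    · rw [m.gen_mul_of_not hi]
      exact m.std_mem_lowerSpan hlen
  | zero => simp
  | add a b _ _ ha hb => rw [mul_add]; exact add_mem ha hb
  | smul c a _ ha => rw [mul_smul_comm]; exact Submodule.smul_mem _ _ ha

end Unitriangular

/-! ### Unitriangularity of the duality, and uniqueness -/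

section Duality

theorem dual_smul (c : ℤ[T;T⁻¹]) (a : H) :
    m.dual (c • a) = LaurentPolynomial.invert c • m.dual a := by
  rw [Algebra.smul_def, map_mul, m.dual_algebraMap, Algebra.smul_def]

/-- For `x = s y > y`, `d(h_x) = (h_s + v - v⁻¹) d(h_y)`, and left multiplication by `h_s` raises
the length bound by at most one. -/
theorem isUnitriangular_dual : m.IsUnitriangular fun x => m.dual (m.std x) := by
  intro x
  induction hn : cs.length x generalizing x with
  | zero =>
    rw [cs.length_eq_zero_iff.mp hn]
    simp [m.std_one]
  | succ n ih =>
    obtain ⟨i, y, hy, rfl⟩ := exists_simple_mul_eq cs (x := x) (by rintro rfl; simp at hn)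
    have hlen := cs.not_isLeftDescent_iff.mp hy
    have hyn : cs.length y = n := by omega
    have h := ih y hyn
    have e : m.dual (m.std (cs.simple i * y)) - m.std (cs.simple i * y) =
        m.gen i * (m.dual (m.std y) - m.std y) +
          (v - vInv) • ((m.dual (m.std y) - m.std y) + m.std y) := by
      rw [← m.gen_mul_of_not hy, map_mul, m.dual_gen, add_mul,
        mul_sub, ← Algebra.smul_def, sub_add_cancel]
      abel
    simp only at h ⊢
    rw [e]
    exact add_mem (m.gen_mul_mem_lowerSpan h i) (Submodule.smul_mem _ _
      (add_mem (m.lowerSpan_mono (Nat.le_succ n) h) (m.std_mem_lowerSpan (by omega))))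

/-- An element is self-dual if it is fixed by the duality. -/
def IsSelfDual (a : H) : Prop := m.dual a = a

/-- The subgroup of self-dual elements. -/
def selfDual : AddSubgroup (H) where
  carrier := {a | m.IsSelfDual a}
  zero_mem' := map_zero _
  add_mem' {a b} ha hb := by
    change m.dual (a + b) = a + b
    rw [map_add, ha, hb]
  neg_mem' {a} ha := by
    change m.dual (-a) = -a
    rw [map_neg, ha]

theorem repr_of_mem_vSum {Y : Set W} {a : H} (h : a ∈ m.vSum Y) (x : W) :
    ∃ p : Polynomial ℤ, m.basis.repr a x = v * Polynomial.toLaurent p := by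
  classical
  induction h using AddSubgroup.closure_induction with
  | mem a ha =>
    obtain ⟨y, _, p, rfl⟩ := ha
    refine ⟨if y = x then p else 0, ?_⟩
    rw [map_smul, m.repr_std, Finsupp.smul_apply, Finsupp.single_apply]
    split_ifs <;> simp
  | zero => exact ⟨0, by simp⟩
  | add a b _ _ ha hb =>
    obtain ⟨p, hp⟩ := ha
    obtain ⟨q, hq⟩ := hb
    exact ⟨p + q, by rw [map_add, Finsupp.add_apply, hp, hq, map_add, mul_add]⟩
  | neg a _ ha =>
    obtain ⟨p, hp⟩ := ha
    exact ⟨-p, by rw [map_neg, Finsupp.neg_apply, hp, map_neg, mul_neg]⟩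

/-- The only self-dual element of `∑ v ℤ[v] h_y` is zero. -/
theorem eq_zero_of_isSelfDual {a : H} (ha : m.IsSelfDual a)
    (h : a ∈ m.vSum (Set.univ : Set W)) : a = 0 := by
  set c := m.basis.repr a with hc
  by_contra hne
  have hc0 : c ≠ 0 := fun h0 => hne (m.basis.repr.map_eq_zero_iff.mp h0)
  obtain ⟨x, hx, hmax⟩ := c.support.exists_max_image cs.length
    (Finsupp.support_nonempty_iff.mpr hc0)
  set c' : W →₀ ℤ[T;T⁻¹] := c.mapRange LaurentPolynomial.invert (map_zero _) with hc'
  have hsum : m.dual a =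
      Finsupp.linearCombination ℤ[T;T⁻¹] (fun x => m.dual (m.std x)) c' := by
    rw [hc', Finsupp.linearCombination_apply, Finsupp.sum_mapRange_index (by simp),
      Finsupp.sum]
    nth_rw 1 [← m.basis.linearCombination_repr a]
    rw [← hc, Finsupp.linearCombination_apply, Finsupp.sum, map_sum]
    refine Finset.sum_congr rfl fun y _ => ?_
    rw [m.dual_smul, m.basis_apply]
  -- At the longest element `x`, the coefficient of `d(a)` is that of `a` with `v` inverted;
  -- self-duality makes it invariant.
  have key := m.repr_linearCombination m.isUnitriangular_dual c' (x := x)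
    fun y hy => hmax y (Finsupp.support_mapRange hy)
  rw [← hsum, ha, ← hc, hc', Finsupp.mapRange_apply] at key
  obtain ⟨p, hp⟩ := m.repr_of_mem_vSum h x
  rw [← hc] at hp
  rw [hp] at key
  exact Finsupp.mem_support_iff.mp hx (hp.trans (eq_zero_of_invert_eq_self key.symm))

end Duality

/-! ### Existence and the Kazhdan–Lusztig basis -/

section Existence

theorem smul_std_mem_vSum {Y : Set W} {y : W} (hy : y ∈ Y) (p : Polynomial ℤ) :
    (v * Polynomial.toLaurent p) • m.std y ∈ m.vSum Y :=
  AddSubgroup.subset_closure ⟨y, hy, p, rfl⟩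

theorem vSum_mono {Y Z : Set W} (h : Y ⊆ Z) : m.vSum Y ≤ m.vSum Z :=
  AddSubgroup.closure_mono fun _ ⟨y, hy, p, e⟩ => ⟨y, h hy, p, e⟩

theorem vSum_bruhatLT_le_lowerSpan (x : W) :
    m.vSum {y | BruhatLT cs y x} ≤ (m.lowerSpan (cs.length x)).toAddSubgroup := by
  refine (AddSubgroup.closure_le _).mpr ?_
  rintro _ ⟨y, hy, p, rfl⟩
  exact Submodule.smul_mem _ _ (m.std_mem_lowerSpan hy.length_lt)

/-- `h_s + v` is self-dual. -/
theorem isSelfDual_gen_add (i : B) :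
    m.IsSelfDual (m.gen i + algebraMap ℤ[T;T⁻¹] (H) v) := by
  rw [IsSelfDual, map_add, m.dual_gen, m.dual_algebraMap, invert_v, add_assoc, ← map_add,
    sub_add_cancel]

/-- `(h_s + v) h_z` is `h_{sz} + v h_z` if `s z > z` and `h_{sz} + v⁻¹ h_z` if `s z < z`. Only the
factor `v⁻¹` can leave `v ℤ[v]`, and the self-dual summand absorbs this. -/
theorem gen_add_mul_mem {i : B} {y : W} (hy : ¬ cs.IsLeftDescent y i)
    (hb : ∀ z, BruhatLT cs z y → ∃ b : H, m.IsSelfDual b ∧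
      b - m.std z ∈ m.vSum {u | BruhatLT cs u z})
    {r : H} (hr : r ∈ m.vSum {z | BruhatLT cs z y}) :
    (m.gen i + algebraMap ℤ[T;T⁻¹] (H) v) * r ∈
      m.vSum {z | BruhatLT cs z (cs.simple i * y)} ⊔ m.selfDual := by
  induction hr using AddSubgroup.closure_induction with
  | mem r hr =>
    obtain ⟨z, hz, p, rfl⟩ := hr
    have hz' : BruhatLT cs z y := hz
    have hzx : BruhatLT cs z (cs.simple i * y) := hz'.trans (bruhatLT_simple_mul hy)
    have hsz : BruhatLT cs (cs.simple i * z) (cs.simple i * y) := hz'.simple_mul hy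
    rw [mul_smul_comm, add_mul, ← Algebra.smul_def]
    by_cases hi : cs.IsLeftDescent z i
    · obtain ⟨b, hb1, hb2⟩ := hb z hz'
      have hlow : b - m.std z ∈ m.vSum {u | BruhatLT cs u (cs.simple i * y)} :=
        m.vSum_mono (fun u hu => BruhatLT.trans hu hzx) hb2
      -- The constant term of `p` is the obstruction; it is carried by the multiple `p.coeff 0 • b`
      -- of the self-dual element for `z`.
      have hp : (v * Polynomial.toLaurent p) * vInv =
          v * Polynomial.toLaurent p.divX + algebraMap ℤ ℤ[T;T⁻¹] (p.coeff 0) := by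
        rw [mul_right_comm, v_mul_vInv, one_mul]
        conv_lhs => rw [← p.divX_mul_X_add]
        rw [map_add, map_mul, Polynomial.toLaurent_X, Polynomial.toLaurent_C, v, mul_comm,
          LaurentPolynomial.C_eq_algebraMap]
      have e : (v * Polynomial.toLaurent p) • (m.gen i * m.std z + v • m.std z) =
          ((v * Polynomial.toLaurent p) • m.std (cs.simple i * z) +
            (v * Polynomial.toLaurent p.divX) • m.std z - p.coeff 0 • (b - m.std z))
          + p.coeff 0 • b := by
        rw [m.gen_mul_of hi, add_assoc, ← add_smul, sub_add_cancel,
          smul_add, smul_smul, hp, add_smul, smul_sub, algebraMap_smul]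
        abel
      rw [e]
      refine AddSubgroup.add_mem_sup ?_ (zsmul_mem (K := m.selfDual) hb1 _)
      exact sub_mem (add_mem (m.smul_std_mem_vSum hsz _) (m.smul_std_mem_vSum hzx _))
        (zsmul_mem hlow _)
    · refine AddSubgroup.mem_sup_left ?_
      have hp : (v * Polynomial.toLaurent p) * v = v * Polynomial.toLaurent (p * Polynomial.X) := by
        rw [map_mul, Polynomial.toLaurent_X, mul_assoc, v]
      rw [m.gen_mul_of_not hi, smul_add, smul_smul, hp]
      exact add_mem (m.smul_std_mem_vSum hsz _) (m.smul_std_mem_vSum hzx _)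
  | zero => simp
  | add a b _ _ ha hb => rw [mul_add]; exact add_mem ha hb
  | neg a _ ha => rw [mul_neg]; exact neg_mem ha

/-- For `x = s y > y`, `(h_s + v) b_y` is self-dual, and a self-dual correction `k` removes the
terms with coefficients outside `v ℤ[v]`. -/
theorem exists_isSelfDual (x : W) : ∃ b : H, m.IsSelfDual b ∧
    b - m.std x ∈ m.vSum {y | BruhatLT cs y x} := by
  induction hn : cs.length x using Nat.strong_induction_on generalizing x with
  | _ n ih =>
    by_cases hx : x = 1
    · refine ⟨1, map_one _, ?_⟩
      rw [hx, m.std_one, sub_self]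
      exact zero_mem _
    obtain ⟨i, y, hy, rfl⟩ := exists_simple_mul_eq cs hx
    have hyx := bruhatLT_simple_mul hy
    obtain ⟨b, hb1, hb2⟩ := ih _ (hn ▸ hyx.length_lt) y rfl
    obtain ⟨a, ha, k, hk, e⟩ := AddSubgroup.mem_sup.mp (m.gen_add_mul_mem hy
      (fun z hz => ih _ (hn ▸ hz.length_lt.trans hyx.length_lt) z rfl) hb2)
    refine ⟨(m.gen i + algebraMap ℤ[T;T⁻¹] (H) v) * b - k, ?_, ?_⟩
    · rw [IsSelfDual, map_sub, map_mul, m.isSelfDual_gen_add, hb1, show m.dual k = k from hk]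
    · have e' : (m.gen i + algebraMap ℤ[T;T⁻¹] (H) v) * b - k - m.std (cs.simple i * y) =
          a + (v * Polynomial.toLaurent 1) • m.std y := by
        rw [← m.gen_mul_of_not hy, map_one, mul_one, Algebra.smul_def,
          eq_sub_of_add_eq e, mul_sub, add_mul, add_mul]
        abel
      rw [e']
      exact add_mem ha (m.smul_std_mem_vSum hyx 1)

theorem eq_of_isSelfDual {x : W} {b b' : H} (hb : m.IsSelfDual b) (hb' : m.IsSelfDual b')
    (h : b - m.std x ∈ m.vSum Set.univ) (h' : b' - m.std x ∈ m.vSum Set.univ) :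
    b = b' := by
  refine sub_eq_zero.mp (m.eq_zero_of_isSelfDual (sub_mem (H := m.selfDual) hb hb') ?_)
  simpa using sub_mem h h'

/-- The Kazhdan-Lusztig theorem. -/
theorem kazhdanLusztig :
    (∀ x : W, ∃! b : H, m.IsSelfDual b ∧ b - m.std x ∈ m.vSum Set.univ) ∧
    (∀ x : W, ∃! b : H, m.IsSelfDual b ∧ b - m.std x ∈ m.vSum {y | BruhatLT cs y x}) ∧
    (∃ b : Module.Basis W ℤ[T;T⁻¹] H, ∀ x : W, m.IsSelfDual (b x) ∧
      b x - m.std x ∈ m.vSum {y | BruhatLT cs y x}) := by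
  choose b hb hlow using m.exists_isSelfDual
  have huniv : ∀ {x : W} {c : H}, c - m.std x ∈ m.vSum {y | BruhatLT cs y x} →
      c - m.std x ∈ m.vSum Set.univ := fun h => m.vSum_mono (Set.subset_univ _) h
  have htri : m.IsUnitriangular b := fun x => m.vSum_bruhatLT_le_lowerSpan x (hlow x)
  refine ⟨fun x => ⟨b x, ⟨hb x, huniv (hlow x)⟩, fun c hc => ?_⟩,
    fun x => ⟨b x, ⟨hb x, hlow x⟩, fun c hc => ?_⟩,
    Module.Basis.mk (m.linearIndependent htri) (m.top_le_span htri), fun x => ?_⟩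
  · exact m.eq_of_isSelfDual hc.1 (hb x) hc.2 (huniv (hlow x))
  · exact m.eq_of_isSelfDual hc.1 (hb x) (huniv hc.2) (huniv (hlow x))
  · rw [Module.Basis.mk_apply]
    exact ⟨hb x, hlow x⟩

end Existence

end HeckeModel

/-- The Hecke algebra with its standard basis and duality. -/
def heckeModel : HeckeModel cs (Hecke M) where
  gen := gen M
  std := stdElt cs
  basis := stdBasis cs
  basis_apply := stdBasis_apply cs
  dual := duality M
  std_one := stdElt_one cs
  gen_mul_of_not := gen_mul_stdElt_of_not_isLeftDescent cs
  gen_mul_of := gen_mul_stdElt_of_isLeftDescent cs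
  dual_algebraMap := duality_algebraMap M
  dual_gen := duality_gen M

end KazhdanLusztig

end

theorem theorem3p2 {B W : Type*} [Group W] {M : CoxeterMatrix B} (cs : CoxeterSystem M W) :
    -- uniqueness and existence with the sum over all of `W`
    (∀ x : W, ∃! b : KazhdanLusztig.Hecke M, KazhdanLusztig.IsSelfDual M b ∧
      b - KazhdanLusztig.stdElt cs x ∈ KazhdanLusztig.vSum cs Set.univ) ∧
    -- the same with the sum over the `y` strictly below `x` in the Bruhat order
    (∀ x : W, ∃! b : KazhdanLusztig.Hecke M, KazhdanLusztig.IsSelfDual M b ∧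
      b - KazhdanLusztig.stdElt cs x ∈
        KazhdanLusztig.vSum cs {y | KazhdanLusztig.BruhatLT cs y x}) ∧
    -- these elements form a `ℤ[v, v⁻¹]`-basis of the Hecke algebra
    (∃ b : Module.Basis W (LaurentPolynomial ℤ) (KazhdanLusztig.Hecke M),
      ∀ x : W, KazhdanLusztig.IsSelfDual M (b x) ∧
        b x - KazhdanLusztig.stdElt cs x ∈
          KazhdanLusztig.vSum cs {y | KazhdanLusztig.BruhatLT cs y x}) := by
  -- For `heckeModel`, the self-dual elements and the sums `vSum` unfold to those of the statement.
  exact (KazhdanLusztig.heckeModel cs).kazhdanLusztig
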